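/- **Setting.** Let $(\mathcal X,\mu)$ be a $\sigma$-finite measure space (for instance a Borel subset of $\mathbb R^d$ with a $\sigma$-finite Borel measure), $\Theta\subseteq\mathbb R^l$, $\mathcal S\subseteq\mathbb R^q$, $\psi:\Theta\to\mathbb R$, $\phi:\Theta\to\mathbb R^q$, and $S=(S_1,\dots,S_q):\mathcal X\to\mathcal S$ measurable (M1). Put $$L(s;\theta)=\psi(\theta)+\langle s,\phi(\theta)\rangle,\quad h(z;\theta)=e^{L(S(z);\theta)},\quad g(\theta)=\int h(z;\theta)\,\mu(dz),\quad p_\theta(z)=\frac{h(z;\theta)}{g(\theta)},\quad \bar S(\theta)=\int S\,p_\theta\,d\mu .$$ Assume (M2): (a) $\psi,\phi$ are continuous on $\Theta$; (b) for every $\theta\in\Theta$ the integral $\bar S(\theta)$ converges absolutely and lies in $\mathcal S$, and $\bar S$ is continuous on $\Theta$; (c) $\hat\theta:\mathcal S\to\Theta$ is a continuous function with $L(s;\hat\theta(s))=\sup_{\theta\in\Theta}L(s;\theta)$ for all $s\in\mathcal S$; (d) $g$ is positive, finite and continuous on $\Theta$, and $\{\theta\in\Theta: g(\theta)\ge M\}$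 is compact for every $M>0$. Let $\mathcal L=\{\theta\in\Theta:\hat\theta(\bar S(\theta))=\theta\}$ be the set of stationary points of the exact EM map. Assume (M3): either $g(\mathcal L)$ is compact, or $g(\mathcal L\cap K)$ is finite for every compact $K\subseteq\Theta$. Assume moreover that for every compact $K\subseteq\Theta$ there is $\varepsilon>0$ such that, for all $\alpha\in\overline{\mathcal B}(1,\varepsilon)$ and all $u\in\{1,\dots,q\}$, $$\sup_{\theta\in K}\int p_\theta^{\alpha}\,d\mu<\infty\qquad\text{and}\qquad \sup_{\theta\in K}\int S_u^2\,p_\theta^{\alpha}\,d\mu<\infty .$$ **Tempered EM.** Let $T_n>0$ with $T_n\to1$, and set $$\tilde p_{\theta,n}=\frac{p_\theta^{1/T_n}}{\int p_\theta^{1/T_n}\,d\mu},\qquad \tilde S_n(\theta)=\int S\,\tilde p_{\theta,n}\,d\mu,\qquad F_n(\theta)=\hat\theta(\tilde S_n(\theta)).$$ Let $(K_n)_{n\ge0}$ be an increasing sequence of compact sets with $\bigcup_nK_n=\Theta$, such that every compact subset of $\Theta$ is contained in some $K_n$ (for instance $K_n\subseteq\operatorname{int}_\Theta K_{n+1}$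 for all $n$). Let $(\theta_n,p_n)_{n\ge 0}$ be a run of the stable tempered EM: $\theta_0\in K_0$, $p_0=0$, and for every $n$ the E-step is well defined at $\theta_n$ (the integrals defining $\tilde p_{\theta_n,n}$ and $\tilde S_n(\theta_n)$ converge absolutely, and $\tilde S_n(\theta_n)\in\mathcal S$) and $$(\theta_{n+1},p_{n+1})=\begin{cases}(F_n(\theta_n),\,p_n)&\text{if }F_n(\theta_n)\in K_{p_n},\\(\theta_0,\,p_n+1)&\text{otherwise.}\end{cases}$$ **Conclusion.** For every compact $K\subseteq\Theta$, $$\sup_{\theta\in K}\int\Big(\frac{\tilde p_{\theta,n}}{p_\theta}-1\Big)^2p_\theta\,d\mu\;\longrightarrow\;0\qquad(n\to\infty).$$ Moreover, writing $\mathrm{Cl}$ for the closure of $\{\theta_n:n\ge0\}$, for every such run: (i) (a) $\limsup_n p_n<\infty$, and $\mathrm{Cl}$ is a compact subset of $\Theta$; (b) $(g(\theta_n))_n$ converges towards a connected component of $g(\mathcal L\cap\mathrm{Cl})\subseteq g(\mathcal L)$ (the distance of $g(\theta_n)$ to that component tends to $0$); (ii) if $g(\mathcal L\cap\mathrm{Cl})$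 has empty interior, then there is $g^*\in\mathbb R$ such that $g(\theta_n)\to g^*$ and $(\theta_n)_n$ converges towards the nonempty set $\{\theta\in\mathcal L:g(\theta)=g^*\}\cap\mathrm{Cl}$ (the distance of $\theta_n$ to it tends to $0$). -/

import Mathlib

open MeasureTheory Filter Topology Set
open scoped ENNReal

/-- The data of a curved exponential model on a measurable space `X` of latent values: a reference
measure `μ`, a parameter set `Θ ⊆ ℝ^l`, functions `ψ : Θ → ℝ`, `φ : Θ → ℝ^q`, and a sufficient
statistic `S : X → Sdom ⊆ ℝ^q`.  (Functions on `Θ` or `Sdom` are total functions on the ambient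
space, of which only the values on `Θ`, resp. `Sdom`, are ever used.) -/
structure ExpModel (l q : ℕ) (X : Type*) [MeasurableSpace X] where
  μ : Measure X
  Θ : Set (EuclideanSpace ℝ (Fin l))
  Sdom : Set (EuclideanSpace ℝ (Fin q))
  ψ : EuclideanSpace ℝ (Fin l) → ℝ
  φ : EuclideanSpace ℝ (Fin l) → EuclideanSpace ℝ (Fin q)
  S : X → EuclideanSpace ℝ (Fin q)

namespace ExpModel

variable {l q : ℕ} {X : Type*} [MeasurableSpace X]

/-- `L(s; θ) = ψ(θ) + ⟨s, φ(θ)⟩`. -/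
noncomputable def logLik (M : ExpModel l q X) (s : EuclideanSpace ℝ (Fin q))
    (θ : EuclideanSpace ℝ (Fin l)) : ℝ :=
  M.ψ θ + inner ℝ s (M.φ θ)

/-- The complete likelihood `h(z; θ) = exp (L(S(z); θ))`. -/
noncomputable def h (M : ExpModel l q X) (z : X) (θ : EuclideanSpace ℝ (Fin l)) : ℝ :=
  Real.exp (M.logLik (M.S z) θ)

/-- The observed likelihood `g(θ) = ∫ h(z; θ) μ(dz)`. -/
noncomputable def g (M : ExpModel l q X) (θ : EuclideanSpace ℝ (Fin l)) : ℝ :=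
  ∫ z, M.h z θ ∂M.μ

/-- The conditional density `p_θ(z) = h(z; θ) / g(θ)`. -/
noncomputable def dens (M : ExpModel l q X) (θ : EuclideanSpace ℝ (Fin l)) (z : X) : ℝ :=
  M.h z θ / M.g θ

/-- The exact E-step: `S̄(θ) = ∫ S(z) p_θ(z) μ(dz)`. -/
noncomputable def Sbar (M : ExpModel l q X) (θ : EuclideanSpace ℝ (Fin l)) :
    EuclideanSpace ℝ (Fin q) :=
  ∫ z, M.dens θ z • M.S z ∂M.μ

/-- The normalised tempered density `p_θ(z)^(1/T) / ∫ p_θ(z')^(1/T) μ(dz')`. -/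
noncomputable def temperedDens (M : ExpModel l q X) (T : ℝ) (θ : EuclideanSpace ℝ (Fin l))
    (z : X) : ℝ :=
  M.dens θ z ^ (1 / T) / ∫ z', M.dens θ z' ^ (1 / T) ∂M.μ

/-- The tempered E-step: the mean of `S` under the normalised tempered density. -/
noncomputable def temperedS (M : ExpModel l q X) (T : ℝ) (θ : EuclideanSpace ℝ (Fin l)) :
    EuclideanSpace ℝ (Fin q) :=
  ∫ z, M.temperedDens T θ z • M.S z ∂M.μ

/-- The tempered E-step at temperature `T` makes sense at `θ`: the integrals that define it
converge, and its value lies in the domain `Sdom` of the M-step. -/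
structure TemperedStepDefined (M : ExpModel l q X) (T : ℝ)
    (θ : EuclideanSpace ℝ (Fin l)) : Prop where
  integrable_pow : Integrable (fun z => M.dens θ z ^ (1 / T)) M.μ
  integrable_stat : Integrable (fun z => M.temperedDens T θ z • M.S z) M.μ
  mem_Sdom : M.temperedS T θ ∈ M.Sdom

/-- Condition M1. -/
structure CondM1 (M : ExpModel l q X) : Prop where
  sigmaFinite : SigmaFinite M.μ
  measurable_S : Measurable M.S
  S_mem : ∀ z, M.S z ∈ M.Sdom

/-- Condition M2, for the M-step `θhat : Sdom → Θ`. -/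
structure CondM2 (M : ExpModel l q X)
    (θhat : EuclideanSpace ℝ (Fin q) → EuclideanSpace ℝ (Fin l)) : Prop where
  /-- (a) `ψ` and `φ` are continuous on `Θ` -/
  continuousOn_ψ : ContinuousOn M.ψ M.Θ
  continuousOn_φ : ContinuousOn M.φ M.Θ
  /-- (b) `S̄` is finite, continuous on `Θ`, and takes its values in the domain of the M-step -/
  integrable_Sbar : ∀ θ ∈ M.Θ, Integrable (fun z => M.dens θ z • M.S z) M.μ
  continuousOn_Sbar : ContinuousOn M.Sbar M.Θ
  Sbar_mem : ∀ θ ∈ M.Θ, M.Sbar θ ∈ M.Sdom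
  /-- (c) `θhat : Sdom → Θ` is continuous and `θhat s` maximises `L(s; ·)` over `Θ` -/
  mapsTo_θhat : MapsTo θhat M.Sdom M.Θ
  continuousOn_θhat : ContinuousOn θhat M.Sdom
  isMaxOn_θhat : ∀ s ∈ M.Sdom, IsMaxOn (M.logLik s) M.Θ (θhat s)
  /-- (d) `g` is finite, positive, continuous on `Θ`, with compact superlevel sets -/
  integrable_h : ∀ θ ∈ M.Θ, Integrable (fun z => M.h z θ) M.μ
  g_pos : ∀ θ ∈ M.Θ, 0 < M.g θ
  continuousOn_g : ContinuousOn M.g M.Θ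
  isCompact_level : ∀ c : ℝ, 0 < c → IsCompact {θ ∈ M.Θ | c ≤ M.g θ}

/-- The set of stationary points of the exact EM map `θhat ∘ S̄`. -/
def statPoints (M : ExpModel l q X)
    (θhat : EuclideanSpace ℝ (Fin q) → EuclideanSpace ℝ (Fin l)) :
    Set (EuclideanSpace ℝ (Fin l)) :=
  {θ ∈ M.Θ | θhat (M.Sbar θ) = θ}

/-- Condition M3: either `g(ℒ)` is compact, or `g(ℒ ∩ K)` is finite for all compact `K ⊆ Θ`. -/
def CondM3 (M : ExpModel l q X)
    (θhat : EuclideanSpace ℝ (Fin q) → EuclideanSpace ℝ (Fin l)) : Prop :=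
  IsCompact (M.g '' M.statPoints θhat) ∨
    ∀ K ⊆ M.Θ, IsCompact K → (M.g '' (M.statPoints θhat ∩ K)).Finite

/-- For every compact `K ⊆ Θ` there is `ε > 0` such that, for all `α` in the closed ball of centre
`1` and radius `ε`, the integrals of `p_θ^α` and of `S_u² p_θ^α` are bounded over `θ ∈ K`. -/
def TemperingCond (M : ExpModel l q X) : Prop :=
  ∀ K ⊆ M.Θ, IsCompact K → ∃ ε : ℝ, 0 < ε ∧ ∀ α ∈ Metric.closedBall (1 : ℝ) ε,
    (⨆ θ ∈ K, ∫⁻ z, ENNReal.ofReal (M.dens θ z ^ α) ∂M.μ) < ∞ ∧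
    ∀ u : Fin q, (⨆ θ ∈ K, ∫⁻ z, ENNReal.ofReal ((M.S z u) ^ 2 * M.dens θ z ^ α) ∂M.μ) < ∞

end ExpModel

/-- `K 0 ⊆ K 1 ⊆ …` is an exhaustion of `Θ` by compact sets: their union is `Θ`, and every compact
subset of `Θ` is contained in one of them. -/
structure IsCompactExhaustion {E : Type*} [TopologicalSpace E] (Θ : Set E) (K : ℕ → Set E) :
    Prop where
  isCompact : ∀ n, IsCompact (K n)
  monotone : Monotone K
  iUnion_eq : ⋃ n, K n = Θ
  exists_subset : ∀ C ⊆ Θ, IsCompact C → ∃ n, C ⊆ K n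

/-- `θ` is the sequence of iterates, and `p` the sequence of restart counters, of the stabilised
iteration of the maps `F n` with truncation sets `K n`: a step that leaves `K (p n)` is rejected,
and the iteration restarts from `θ 0` with the next truncation set. -/
structure IsStableIteration {E : Type*} (K : ℕ → Set E) (F : ℕ → E → E)
    (θ : ℕ → E) (p : ℕ → ℕ) : Prop where
  init_mem : θ 0 ∈ K 0
  init_count : p 0 = 0
  accept : ∀ n, F n (θ n) ∈ K (p n) → θ (n + 1) = F n (θ n) ∧ p (n + 1) = p n
  reject : ∀ n, F n (θ n) ∉ K (p n) → θ (n + 1) = θ 0 ∧ p (n + 1) = p n + 1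

/-- The sequence `u` converges towards the set `A`: `dist (u n, A) → 0`.  The distance to the empty
set is `∞`, so this forces `A` to be nonempty. -/
def ConvergesToSet {E : Type*} [PseudoEMetricSpace E] (u : ℕ → E) (A : Set E) : Prop :=
  Tendsto (fun n => Metric.infEDist (u n) A) atTop (𝓝 0)

/-! Write `G` for the exact EM map. Integrating `exp x ≥ 1 + x` against `p_θ` shows that `g`
increases along `G`. Equality forces `h(·; θ)` and `h(·; G θ)` to agree almost everywhere, so that
`G θ` is stationary (`g_le_map`, `map_map_eq`).

Tempering is a vanishing perturbation. With `α = 1 / T`, the χ² distance from the tempered to the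
exact density is `∫ p^(2α-1) / (∫ p^α)² - 1`. Interpolating in the exponent gives `∫ p^α → 1`
uniformly on compact sets, and Cauchy–Schwarz then brings the tempered E-step to the exact one
(`tendsto_temperedMap`).

The rest is dynamics: if `θ n → x` along an ultrafilter, then `F n (θ n) → G x`. A superlevel set of
`g` at a non-stationary level is therefore eventually invariant, which bounds the number of
restarts. A level crossed downwards infinitely often is a stationary value, so stationary values
fill the gap between any two cluster values of `g (θ n)`. -/

/-! ### Ultrafilter limits and level crossings -/

theorem ConvergesToSet.of_ultrafilter {E : Type*} [PseudoEMetricSpace E] {u : ℕ → E} {A : Set E}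
    (h : ∀ U : Ultrafilter ℕ, (U : Filter ℕ) ≤ atTop → ∃ x ∈ A, Tendsto u U (𝓝 x)) :
    ConvergesToSet u A := by
  refine tendsto_iff_ultrafilter _ _ _ |>.2 fun U hU => ?_
  obtain ⟨x, hx, hux⟩ := h U hU
  have h0 : Tendsto (fun n => edist (u n) x) U (𝓝 0) := tendsto_iff_edist_tendsto_0.1 hux
  exact tendsto_of_tendsto_of_tendsto_of_le_of_le tendsto_const_nhds h0 (fun _ => zero_le)
    (fun n => Metric.infEDist_le_edist_of_mem hx)

theorem Filter.Frequently.exists_ultrafilter {α : Type*} {l : Filter α} {P : α → Prop}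
    (h : ∃ᶠ a in l, P a) : ∃ U : Ultrafilter α, (U : Filter α) ≤ l ∧ ∀ᶠ a in (U : Filter α), P a := by
  have : NeBot (l ⊓ 𝓟 {a | P a}) := frequently_mem_iff_neBot.1 h
  refine ⟨Ultrafilter.of (l ⊓ 𝓟 {a | P a}), (Ultrafilter.of_le _).trans inf_le_left, ?_⟩
  exact (le_principal_iff.1 ((Ultrafilter.of_le (l ⊓ 𝓟 {a | P a})).trans inf_le_right))

theorem IsCompact.exists_tendsto_ultrafilter {α E : Type*} [TopologicalSpace E] {C : Set E}
    (hC : IsCompact C) {u : α → E} (U : Ultrafilter α) (h : ∀ᶠ n in (U : Filter α), u n ∈ C) :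
    ∃ x ∈ C, Tendsto u U (𝓝 x) :=
  hC.ultrafilter_le_nhds (U.map u) (le_principal_iff.2 h)

theorem frequently_downcrossing {u : ℕ → ℝ} {m : ℝ} (h1 : ∃ᶠ n in atTop, u n < m)
    (h2 : ∃ᶠ n in atTop, m < u n) : ∃ᶠ n in atTop, m < u n ∧ u (n + 1) ≤ m := by
  rw [frequently_atTop] at *
  intro N
  obtain ⟨a, haN, ha⟩ := h2 N
  obtain ⟨b, hab, hb⟩ := h1 a
  by_contra! hcon
  have : ∀ n, a ≤ n → m < u n := by
    intro n hn
    induction n, hn using Nat.le_induction with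
    | base => exact ha
    | succ k hk ih => exact hcon k (haN.trans hk) ih
  exact absurd (this b hab) hb.le.not_gt

/-! ### Restarts of the stabilised iteration -/

section Stable

variable {E : Type*} {K : ℕ → Set E} {F : ℕ → E → E} {θ : ℕ → E} {p : ℕ → ℕ}

theorem IsStableIteration.monotone_count (hs : IsStableIteration K F θ p) : Monotone p := by
  refine monotone_nat_of_le_succ fun n => ?_
  by_cases hn : F n (θ n) ∈ K (p n)
  · exact (hs.accept n hn).2.ge
  · exact (hs.reject n hn).2 ▸ Nat.le_succ _

theorem IsStableIteration.mem (hs : IsStableIteration K F θ p) (hK : Monotone K) (n : ℕ) :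
    θ n ∈ K (p n) := by
  induction n with
  | zero => rw [hs.init_count]; exact hs.init_mem
  | succ n ih =>
    by_cases hn : F n (θ n) ∈ K (p n)
    · rw [(hs.accept n hn).1, (hs.accept n hn).2]; exact hn
    · rw [(hs.reject n hn).1]; exact hK (Nat.zero_le _) hs.init_mem

/-- A late enough restart puts the iterate back at `θ 0 ∈ W`. It then never leaves `W`, which lies
in the current truncation set, so no later step is rejected. -/
theorem IsStableIteration.bddAbove_count (hs : IsStableIteration K F θ p) (hK : Monotone K)
    {W : Set E} {N : ℕ} (h0 : θ 0 ∈ W) (hW : W ⊆ K N)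
    (hstep : ∀ᶠ n in atTop, θ n ∈ W → F n (θ n) ∈ W) : ∃ P, ∀ n, p n ≤ P := by
  obtain ⟨n₀, hn₀⟩ := eventually_atTop.1 hstep
  by_contra! hcon
  -- Exceeding `p n₀` puts the restart after time `n₀`; exceeding `N` makes the truncation set
  -- contain `W`.
  have hex := hcon (max N (p n₀))
  classical
  obtain ⟨k, hk⟩ : ∃ k, Nat.find hex = k + 1 := by
    refine Nat.exists_eq_succ_of_ne_zero fun h => ?_
    have := Nat.find_spec hex
    rw [h, hs.init_count] at this
    omega
  have hk1 : max N (p n₀) < p (k + 1) := hk ▸ Nat.find_spec hex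
  have hk2 : p k ≤ max N (p n₀) := not_lt.1 (Nat.find_min hex (by omega))
  have hn : n₀ ≤ k + 1 := by
    by_contra! hlt
    have := hs.monotone_count hlt.le
    omega
  have hrej : F k (θ k) ∉ K (p k) := fun h => by
    have := (hs.accept k h).2
    omega
  have key : ∀ j, k + 1 ≤ j → p j = p (k + 1) ∧ θ j ∈ W := by
    intro j hj
    induction j, hj using Nat.le_induction with
    | base => exact ⟨rfl, (hs.reject k hrej).1 ▸ h0⟩
    | succ j hj ih =>
      have h1 := hn₀ j (hn.trans hj) ih.2
      have h2 := hs.accept j (hK (by omega : N ≤ p j) (hW h1))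
      exact ⟨h2.2.trans ih.1, h2.1 ▸ h1⟩
  obtain ⟨j, hj⟩ := hcon (p (k + 1))
  rcases le_total (k + 1) j with h | h
  · exact hj.ne' (key j h).1
  · exact absurd (hs.monotone_count h) hj.not_ge

theorem IsStableIteration.eventually_accept (hs : IsStableIteration K F θ p) {P : ℕ}
    (hP : ∀ n, p n ≤ P) : ∀ᶠ n in atTop, θ (n + 1) = F n (θ n) := by
  obtain ⟨n₁, hn₁⟩ : ∃ n₁, ∀ n, n₁ ≤ n → p n = p n₁ := by
    by_contra! hcon
    have : ∀ k, ∃ n, k ≤ p n := by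
      intro k
      induction k with
      | zero => exact ⟨0, Nat.zero_le _⟩
      | succ k ih =>
        obtain ⟨n, hn⟩ := ih
        obtain ⟨m, hm, hne⟩ := hcon n
        have := hs.monotone_count hm
        exact ⟨m, by omega⟩
    obtain ⟨n, hn⟩ := this (P + 1)
    have := hP n
    omega
  filter_upwards [eventually_ge_atTop n₁] with n hn
  by_cases h : F n (θ n) ∈ K (p n)
  · exact (hs.accept n h).1
  · have h1 := (hs.reject n h).2
    rw [hn₁ n hn, hn₁ (n + 1) (by omega)] at h1
    omega

end Stable

/-! ### Perturbed ascent dynamics -/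

section Iteration

variable {E : Type*} [MetricSpace E] {F : ℕ → E → E} {θ : ℕ → E} {Θ : Set E} {G : E → E} {g : E → ℝ}

/-- Along the sequence `θ`, the maps `F n` converge continuously on `Θ` to the map `G`, which is
continuous and maps `Θ` to itself; `g` is continuous and increases along `G`, and it increases
strictly unless `G x` is a fixed point of `G`. -/
structure IsAscentLimit (Θ : Set E) (F : ℕ → E → E) (G : E → E) (g : E → ℝ) (θ : ℕ → E) :
    Prop where
  mapsTo : MapsTo G Θ Θ
  continuousOn_map : ContinuousOn G Θ
  continuousOn : ContinuousOn g Θ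
  le_map : ∀ x ∈ Θ, g x ≤ g (G x)
  fixed_of_eq : ∀ x ∈ Θ, g (G x) = g x → G (G x) = G x
  step_mem : ∀ n, F n (θ n) ∈ Θ
  tendsto_step : ∀ U : Ultrafilter ℕ, (U : Filter ℕ) ≤ atTop → ∀ x ∈ Θ, Tendsto θ U (𝓝 x) →
    Tendsto (fun n => F n (θ n)) U (𝓝 (G x))

/-- Infinitely many exits would have a limit point `x` with `g x ≥ c ≥ g (G x)`. Ascent makes these
equalities, so `G x` would be a fixed point with the excluded value `c`. -/
theorem IsAscentLimit.eventually_step_mem_level (h : IsAscentLimit Θ F G g θ) {c : ℝ}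
    (hcomp : IsCompact {x ∈ Θ | c ≤ g x}) (hc : c ∉ g '' {x ∈ Θ | G x = x}) :
    ∀ᶠ n in atTop, θ n ∈ {x ∈ Θ | c ≤ g x} → F n (θ n) ∈ {x ∈ Θ | c ≤ g x} := by
  by_contra hcon
  obtain ⟨U, hU, hUP⟩ := (not_eventually.1 hcon).exists_ultrafilter
  simp only [Classical.not_imp] at hUP
  obtain ⟨x, hx, hUx⟩ := hcomp.exists_tendsto_ultrafilter U (hUP.mono fun _ hn => hn.1)
  have hGx : Tendsto (fun n => F n (θ n)) U (𝓝[Θ] (G x)) :=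
    tendsto_nhdsWithin_iff.2 ⟨h.tendsto_step U hU x hx.1 hUx, Eventually.of_forall h.step_mem⟩
  have hg : Tendsto (fun n => g (F n (θ n))) U (𝓝 (g (G x))) :=
    (h.continuousOn _ (h.mapsTo hx.1)).tendsto.comp hGx
  have hle : g (G x) ≤ c := le_of_tendsto hg (hUP.mono fun n hn => by
    by_contra! hlt
    exact hn.2 ⟨h.step_mem n, hlt.le⟩)
  have h1 := h.le_map x hx.1
  have h2 : c ≤ g x := hx.2
  exact hc ⟨G x, ⟨h.mapsTo hx.1, h.fixed_of_eq x hx.1 (by linarith)⟩, by linarith⟩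

namespace IsAscentLimit

variable (h : IsAscentLimit Θ F G g θ) (hC : IsCompact (closure (range θ)))
  (hCΘ : closure (range θ) ⊆ Θ) (hstep : ∀ᶠ n in atTop, θ (n + 1) = F n (θ n))

include h hC hCΘ in
theorem isClosed_image : IsClosed (g '' ({x ∈ Θ | G x = x} ∩ closure (range θ))) := by
  have h1 : ContinuousOn (fun x => (G x, x)) (closure (range θ)) :=
    (h.continuousOn_map.mono hCΘ).prodMk continuousOn_id
  have h2 : IsClosed (closure (range θ) ∩ (fun x => (G x, x)) ⁻¹' diagonal E) :=
    h1.preimage_isClosed_of_isClosed hC.isClosed isClosed_diagonal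
  have h3 : {x ∈ Θ | G x = x} ∩ closure (range θ) =
      closure (range θ) ∩ (fun x => (G x, x)) ⁻¹' diagonal E := by
    ext x
    simp only [mem_inter_iff, mem_ofPred_eq, mem_preimage, mem_diagonal_iff]
    exact ⟨fun hx => ⟨hx.2, hx.1.2⟩, fun hx => ⟨⟨hCΘ hx.1, hx.2⟩, hx.1⟩⟩
  rw [h3]
  exact ((hC.of_isClosed_subset h2 inter_subset_left).image_of_continuousOn
    (h.continuousOn.mono fun x hx => hCΘ hx.1)).isClosed

theorem exists_tendsto (hC : IsCompact (closure (range θ))) (U : Ultrafilter ℕ) :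
    ∃ x ∈ closure (range θ), Tendsto θ U (𝓝 x) :=
  hC.exists_tendsto_ultrafilter U (Eventually.of_forall fun n => subset_closure ⟨n, rfl⟩)

include h hCΘ in
theorem tendsto_comp {U : Filter ℕ} {k : ℕ → ℕ} {x : E} (hx : x ∈ closure (range θ))
    (hUx : Tendsto (fun n => θ (k n)) U (𝓝 x)) : Tendsto (fun n => g (θ (k n))) U (𝓝 (g x)) :=
  (h.continuousOn x (hCΘ hx)).tendsto.comp (tendsto_nhdsWithin_iff.2
    ⟨hUx, Eventually.of_forall fun n => hCΘ (subset_closure ⟨k n, rfl⟩)⟩)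

include h hCΘ hstep in
theorem tendsto_succ {U : Ultrafilter ℕ} (hU : (U : Filter ℕ) ≤ atTop) {x : E}
    (hx : x ∈ closure (range θ)) (hUx : Tendsto θ U (𝓝 x)) :
    Tendsto (fun n => θ (n + 1)) U (𝓝 (G x)) ∧ G x ∈ closure (range θ) := by
  have h1 : Tendsto (fun n => θ (n + 1)) U (𝓝 (G x)) :=
    (h.tendsto_step U hU x (hCΘ hx) hUx).congr'
      ((hstep.filter_mono hU).mono fun n hn => hn.symm)
  exact ⟨h1, mem_closure_of_tendsto h1 (Eventually.of_forall fun n => ⟨n + 1, rfl⟩)⟩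

include h hC hCΘ hstep in
-- At a limit point `x` of the downcrossing times, `g x ≥ m ≥ g (G x) ≥ g x`, so `G x` is a fixed
-- point with value `m`.
theorem mem_image_of_frequently {m : ℝ} (h1 : ∃ᶠ n in atTop, g (θ n) < m)
    (h2 : ∃ᶠ n in atTop, m < g (θ n)) : m ∈ g '' ({x ∈ Θ | G x = x} ∩ closure (range θ)) := by
  obtain ⟨U, hU, hUP⟩ := (frequently_downcrossing h1 h2).exists_ultrafilter
  obtain ⟨x, hx, hUx⟩ := exists_tendsto hC U
  obtain ⟨hUG, hGx⟩ := h.tendsto_succ hCΘ hstep hU hx hUx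
  have a1 : m ≤ g x := ge_of_tendsto (h.tendsto_comp (k := id) hCΘ hx hUx)
    (hUP.mono fun n hn => hn.1.le)
  have a2 : g (G x) ≤ m := le_of_tendsto (h.tendsto_comp hCΘ hGx hUG) (hUP.mono fun n hn => hn.2)
  have a3 := h.le_map x (hCΘ hx)
  exact ⟨G x, ⟨⟨hCΘ hGx, h.fixed_of_eq x (hCΘ hx) (by linarith)⟩, hGx⟩, by linarith⟩

include h hC hCΘ hstep in
theorem Ioo_subset_image {a b : ℝ} (ha : MapClusterPt a atTop fun n => g (θ n))
    (hb : MapClusterPt b atTop fun n => g (θ n)) :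
    Ioo a b ⊆ g '' ({x ∈ Θ | G x = x} ∩ closure (range θ)) := fun _ hm =>
  h.mem_image_of_frequently hC hCΘ hstep (ha.frequently (Iio_mem_nhds hm.1))
    (hb.frequently (Ioi_mem_nhds hm.2))

include h hC hCΘ in
theorem exists_tendsto_mapClusterPt {U : Ultrafilter ℕ} (hU : (U : Filter ℕ) ≤ atTop) :
    ∃ c, Tendsto (fun n => g (θ n)) U (𝓝 c) ∧ MapClusterPt c atTop fun n => g (θ n) := by
  obtain ⟨x, hx, hUx⟩ := exists_tendsto hC U
  have h1 := h.tendsto_comp (k := id) hCΘ hx hUx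
  exact ⟨g x, h1, mapClusterPt_iff_ultrafilter.2 ⟨U, hU, h1⟩⟩

include h hC hCΘ hstep in
theorem mem_image_of_tendsto {c : ℝ} (hc : Tendsto (fun n => g (θ n)) atTop (𝓝 c)) :
    c ∈ g '' ({x ∈ Θ | G x = x} ∩ closure (range θ)) := by
  have hU : ((hyperfilter ℕ : Ultrafilter ℕ) : Filter ℕ) ≤ atTop := Nat.hyperfilter_le_atTop
  obtain ⟨x, hx, hUx⟩ := exists_tendsto hC (hyperfilter ℕ)
  obtain ⟨hUG, hGx⟩ := h.tendsto_succ hCΘ hstep hU hx hUx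
  have a1 : g x = c := tendsto_nhds_unique (h.tendsto_comp (k := id) hCΘ hx hUx) (hc.mono_left hU)
  have a2 : g (G x) = c := tendsto_nhds_unique (h.tendsto_comp hCΘ hGx hUG)
    ((hc.comp (tendsto_add_atTop_nat 1)).mono_left hU)
  exact ⟨G x, ⟨⟨hCΘ hGx, h.fixed_of_eq x (hCΘ hx) (a2.trans a1.symm)⟩, hGx⟩, a2⟩

include h hC hCΘ in
theorem exists_tendsto_or_lt : (∃ c, Tendsto (fun n => g (θ n)) atTop (𝓝 c)) ∨
    ∃ a b, a < b ∧ MapClusterPt a atTop (fun n => g (θ n)) ∧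
      MapClusterPt b atTop (fun n => g (θ n)) := by
  obtain ⟨c, -, hc⟩ := h.exists_tendsto_mapClusterPt hC hCΘ
    (U := hyperfilter ℕ) Nat.hyperfilter_le_atTop
  by_cases hall : ∀ d, MapClusterPt d atTop (fun n => g (θ n)) → d = c
  · refine Or.inl ⟨c, tendsto_iff_ultrafilter _ _ _ |>.2 fun U hU => ?_⟩
    obtain ⟨d, hUd, hd⟩ := h.exists_tendsto_mapClusterPt hC hCΘ hU
    rwa [← hall d hd]
  · push Not at hall
    obtain ⟨d, hd, hne⟩ := hall
    rcases lt_or_gt_of_ne hne with hlt | hlt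
    · exact Or.inr ⟨d, c, hlt, hd, hc⟩
    · exact Or.inr ⟨c, d, hlt, hc, hd⟩

include h hC hCΘ hstep in
-- The segment between two cluster values lies in the closed set of stationary values, so all
-- cluster values share one component.
theorem exists_convergesToSet_component :
    ∃ w ∈ g '' ({x ∈ Θ | G x = x} ∩ closure (range θ)), ConvergesToSet (fun n => g (θ n))
      (connectedComponentIn (g '' ({x ∈ Θ | G x = x} ∩ closure (range θ))) w) := by
  rcases h.exists_tendsto_or_lt hC hCΘ with ⟨c, hc⟩ | ⟨a, b, hab, ha, hb⟩
  · have hcA := h.mem_image_of_tendsto hC hCΘ hstep hc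
    exact ⟨c, hcA, .of_ultrafilter fun U hU => ⟨c, mem_connectedComponentIn hcA, hc.mono_left hU⟩⟩
  -- As `a < w < b`, any cluster value `c` can be paired with `b` (if `c ≤ w`) or `a` (if `w ≤ c`),
  -- giving a nondegenerate segment that contains both `c` and `w`.
  · obtain ⟨w, haw, hwb⟩ := exists_between hab
    refine ⟨w, h.Ioo_subset_image hC hCΘ hstep ha hb ⟨haw, hwb⟩, .of_ultrafilter fun U hU => ?_⟩
    obtain ⟨c, hUc, hc⟩ := h.exists_tendsto_mapClusterPt hC hCΘ hU
    have key : ∀ {r s : ℝ}, r < s → MapClusterPt r atTop (fun n => g (θ n)) →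
        MapClusterPt s atTop (fun n => g (θ n)) →
        Icc r s ⊆ g '' ({x ∈ Θ | G x = x} ∩ closure (range θ)) := fun hrs hr hs => by
      rw [← closure_Ioo hrs.ne]
      exact closure_minimal (h.Ioo_subset_image hC hCΘ hstep hr hs) (h.isClosed_image hC hCΘ)
    refine ⟨c, ?_, hUc⟩
    rcases le_total c w with hcw | hcw
    · exact isPreconnected_Icc.subset_connectedComponentIn (right_mem_Icc.2 hcw)
        ((Icc_subset_Icc_right hwb.le).trans (key (hcw.trans_lt hwb) hc hb)) (left_mem_Icc.2 hcw)
    · exact isPreconnected_Icc.subset_connectedComponentIn (left_mem_Icc.2 hcw)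
        ((Icc_subset_Icc_left haw.le).trans (key (haw.trans_le hcw) ha hc)) (right_mem_Icc.2 hcw)

include h hC hCΘ hstep in
-- A limit point `x` equals `G y`, where `y` is the limit of the preceding iterates. Both have value
-- `c`, so the step from `y` gains nothing and `x` is fixed.
theorem convergesToSet_of_tendsto {c : ℝ} (hc : Tendsto (fun n => g (θ n)) atTop (𝓝 c)) :
    ConvergesToSet θ ({t ∈ {x ∈ Θ | G x = x} | g t = c} ∩ closure (range θ)) := by
  refine .of_ultrafilter fun U hU => ?_
  obtain ⟨x, hx, hUx⟩ := exists_tendsto hC U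
  have hV : ((U.map Nat.pred : Ultrafilter ℕ) : Filter ℕ) ≤ atTop :=
    (tendsto_sub_atTop_nat 1).mono_left hU
  obtain ⟨y, hy, hVy⟩ := exists_tendsto hC (U.map Nat.pred)
  obtain ⟨hVG, -⟩ := h.tendsto_succ hCΘ hstep hV hy hVy
  have hxy : G y = x := by
    refine tendsto_nhds_unique (f := θ) (l := U) ?_ hUx
    have h1 : Tendsto (fun n => θ (Nat.pred n + 1)) U (𝓝 (G y)) := hVG
    refine h1.congr' (((eventually_ge_atTop 1).filter_mono hU).mono fun n hn => ?_)
    rw [Nat.pred_eq_sub_one, Nat.sub_add_cancel hn]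
  have gx : g x = c :=
    tendsto_nhds_unique (h.tendsto_comp (k := id) hCΘ hx hUx) (hc.mono_left hU)
  have gy : g y = c :=
    tendsto_nhds_unique (h.tendsto_comp (k := id) hCΘ hy hVy) (hc.mono_left hV)
  have hfix := h.fixed_of_eq y (hCΘ hy) (by rw [hxy, gx, gy])
  rw [hxy] at hfix
  exact ⟨x, ⟨⟨⟨hCΘ hx, hfix⟩, gx⟩, hx⟩, hUx⟩

include h hC hCΘ hstep in
theorem exists_tendsto_of_interior_eq_empty
    (hint : interior (g '' ({x ∈ Θ | G x = x} ∩ closure (range θ))) = ∅) :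
    ∃ c, Tendsto (fun n => g (θ n)) atTop (𝓝 c) := by
  refine (h.exists_tendsto_or_lt hC hCΘ).resolve_right ?_
  rintro ⟨a, b, hab, ha, hb⟩
  have := interior_maximal (h.Ioo_subset_image hC hCΘ hstep ha hb) isOpen_Ioo
  rw [hint, subset_empty_iff, Ioo_eq_empty_iff] at this
  exact this hab

end IsAscentLimit

end Iteration

/-! ### Monotonicity of exact EM -/

namespace ExpModel

variable {l q : ℕ} {X : Type*} [MeasurableSpace X] {M : ExpModel l q X}
  {θhat : EuclideanSpace ℝ (Fin q) → EuclideanSpace ℝ (Fin l)}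
  {θ θ' : EuclideanSpace ℝ (Fin l)}

theorem h_pos (z : X) (θ : EuclideanSpace ℝ (Fin l)) : 0 < M.h z θ := Real.exp_pos _

theorem CondM1.measurable_h (hM1 : M.CondM1) (θ : EuclideanSpace ℝ (Fin l)) :
    Measurable fun z => M.h z θ := by
  have := hM1.measurable_S
  unfold h logLik
  fun_prop

theorem CondM1.measurable_dens (hM1 : M.CondM1) (θ : EuclideanSpace ℝ (Fin l)) :
    Measurable (M.dens θ) := (hM1.measurable_h θ).div_const _

namespace CondM2

variable (hM2 : M.CondM2 θhat)
include hM2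

theorem dens_pos (hθ : θ ∈ M.Θ) (z : X) : 0 < M.dens θ z := div_pos (h_pos z θ) (hM2.g_pos θ hθ)

theorem integrable_dens (hθ : θ ∈ M.Θ) : Integrable (M.dens θ) M.μ :=
  (hM2.integrable_h θ hθ).div_const _

theorem integral_dens (hθ : θ ∈ M.Θ) : ∫ z, M.dens θ z ∂M.μ = 1 := by
  unfold dens
  rw [integral_div]
  exact div_self (hM2.g_pos θ hθ).ne'

theorem integrable_dens_mul_sub (hθ : θ ∈ M.Θ) (θ' : EuclideanSpace ℝ (Fin l)) :
    Integrable (fun z => M.dens θ z * (M.logLik (M.S z) θ' - M.logLik (M.S z) θ)) M.μ ∧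
    ∫ z, M.dens θ z * (M.logLik (M.S z) θ' - M.logLik (M.S z) θ) ∂M.μ =
      M.logLik (M.Sbar θ) θ' - M.logLik (M.Sbar θ) θ := by
  have e : (fun z => M.dens θ z * (M.logLik (M.S z) θ' - M.logLik (M.S z) θ)) =
      fun z => M.dens θ z * (M.ψ θ' - M.ψ θ) +
        inner ℝ (M.φ θ' - M.φ θ) (M.dens θ z • M.S z) := by
    funext z
    simp only [logLik, inner_smul_right, real_inner_comm (M.S z), inner_sub_right]
    ring
  have i1 := (hM2.integrable_dens hθ).mul_const (M.ψ θ' - M.ψ θ)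
  have i2 := (hM2.integrable_Sbar θ hθ).const_inner (𝕜 := ℝ) (M.φ θ' - M.φ θ)
  rw [e]
  refine ⟨i1.add i2, ?_⟩
  rw [integral_add i1 i2, integral_mul_const, hM2.integral_dens hθ,
    integral_inner (hM2.integrable_Sbar θ hθ)]
  change _ + inner ℝ _ (M.Sbar θ) = _
  simp only [logLik, real_inner_comm (M.Sbar θ), inner_sub_right]
  ring

/-- The log-likelihood difference is affine in `S`, so its `p_θ`-mean is its value at `S̄(θ)`, while
`p_θ` times its exponential is `h(·; θ') / g(θ)`. The integrand is nonnegative, which yields both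
ascent and its equality case. -/
theorem integral_excess (hθ : θ ∈ M.Θ) (hθ' : θ' ∈ M.Θ) :
    Integrable (fun z => M.dens θ z * (Real.exp (M.logLik (M.S z) θ' - M.logLik (M.S z) θ) -
      (M.logLik (M.S z) θ' - M.logLik (M.S z) θ) - 1)) M.μ ∧
    ∫ z, M.dens θ z * (Real.exp (M.logLik (M.S z) θ' - M.logLik (M.S z) θ) -
      (M.logLik (M.S z) θ' - M.logLik (M.S z) θ) - 1) ∂M.μ =
      M.g θ' / M.g θ - (M.logLik (M.Sbar θ) θ' - M.logLik (M.Sbar θ) θ) - 1 := by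
  obtain ⟨i1, e1⟩ := hM2.integrable_dens_mul_sub hθ θ'
  have i2 := (hM2.integrable_h θ' hθ').div_const (M.g θ)
  have i3 := hM2.integrable_dens hθ
  have e : (fun z => M.dens θ z * (Real.exp (M.logLik (M.S z) θ' - M.logLik (M.S z) θ) -
      (M.logLik (M.S z) θ' - M.logLik (M.S z) θ) - 1)) =
      fun z => M.h z θ' / M.g θ -
        M.dens θ z * (M.logLik (M.S z) θ' - M.logLik (M.S z) θ) - M.dens θ z := by
    funext z
    have := (Real.exp_pos (M.logLik (M.S z) θ)).ne'
    simp only [dens, h, Real.exp_sub]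
    field_simp
  rw [e]
  refine ⟨(i2.sub i1).sub i3, ?_⟩
  have e3 := integral_sub (i2.sub i1) i3
  have e4 := integral_sub i2 i1
  simp only [Pi.sub_apply] at e3 e4
  rw [e3, e4, integral_div, e1, hM2.integral_dens hθ]
  rfl

theorem excess_nonneg (hθ : θ ∈ M.Θ) (θ' : EuclideanSpace ℝ (Fin l)) :
    0 ≤ fun z => M.dens θ z * (Real.exp (M.logLik (M.S z) θ' - M.logLik (M.S z) θ) -
      (M.logLik (M.S z) θ' - M.logLik (M.S z) θ) - 1) := by
  intro z
  have := Real.add_one_le_exp (M.logLik (M.S z) θ' - M.logLik (M.S z) θ)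
  exact mul_nonneg (hM2.dens_pos hθ z).le (by linarith)

theorem mapsTo_map : MapsTo (fun t => θhat (M.Sbar t)) M.Θ M.Θ := fun t ht =>
  hM2.mapsTo_θhat (hM2.Sbar_mem t ht)

theorem logLik_le_map (hθ : θ ∈ M.Θ) :
    M.logLik (M.Sbar θ) θ ≤ M.logLik (M.Sbar θ) (θhat (M.Sbar θ)) :=
  hM2.isMaxOn_θhat _ (hM2.Sbar_mem θ hθ) hθ

/-- The exact EM map increases the observed likelihood. -/
theorem g_le_map (hθ : θ ∈ M.Θ) : M.g θ ≤ M.g (θhat (M.Sbar θ)) := by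
  have h1 := (hM2.integral_excess hθ (hM2.mapsTo_map hθ)).2
  have h2 := integral_nonneg (μ := M.μ) (hM2.excess_nonneg hθ (θhat (M.Sbar θ)))
  rw [h1] at h2
  have h3 := hM2.logLik_le_map hθ
  rw [← one_le_div₀ (hM2.g_pos θ hθ)]
  linarith

/-- If the exact EM map does not increase the observed likelihood at `θ`, then it sends `θ` to a
stationary point. -/
theorem map_map_eq (hθ : θ ∈ M.Θ) (heq : M.g (θhat (M.Sbar θ)) = M.g θ) :
    θhat (M.Sbar (θhat (M.Sbar θ))) = θhat (M.Sbar θ) := by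
  have hθ' : θhat (M.Sbar θ) ∈ M.Θ := hM2.mapsTo_map hθ
  obtain ⟨i1, h1⟩ := hM2.integral_excess hθ hθ'
  have h0 := hM2.excess_nonneg hθ (θhat (M.Sbar θ))
  have h2 := integral_nonneg (μ := M.μ) h0
  have h3 := hM2.logLik_le_map hθ
  -- Equal `g` and maximality of the M-step make the integral nonpositive, so the excess vanishes
  -- almost everywhere.
  have h4 := (integral_eq_zero_iff_of_nonneg h0 i1).1 (le_antisymm (h1.trans_le (by
    rw [heq, div_self (hM2.g_pos θ hθ).ne']; linarith)) h2)
  congr 1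
  refine integral_congr_ae (h4.mono fun z hz => ?_)
  have hz' : M.logLik (M.S z) (θhat (M.Sbar θ)) - M.logLik (M.S z) θ = 0 := by
    by_contra hne
    have := Real.add_one_lt_exp hne
    have := mul_pos (hM2.dens_pos hθ z) (sub_pos.2 this)
    simp only [Pi.zero_apply] at hz
    linarith
  change M.dens _ z • M.S z = M.dens _ z • M.S z
  rw [dens, dens, heq, h, h, sub_eq_zero.1 hz']

omit hM2 in
-- If the set of stationary values is compact, half its minimum lies below all of them. Otherwise
-- only finitely many are attained on a compact superlevel set, and an interval has room to avoid
-- them.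
theorem exists_level_notMem (hM2 : M.CondM2 θhat) (hM3 : M.CondM3 θhat) (hθ : θ ∈ M.Θ) :
    ∃ c, 0 < c ∧ c ≤ M.g θ ∧ c ∉ M.g '' M.statPoints θhat := by
  have hg := hM2.g_pos θ hθ
  rcases hM3 with hc | hf
  · rcases (M.g '' M.statPoints θhat).eq_empty_or_nonempty with he | hne
    · exact ⟨M.g θ, hg, le_rfl, by simp [he]⟩
    · obtain ⟨m, ⟨x, hx, rfl⟩, hm⟩ := hc.exists_isLeast hne
      have hgx := hM2.g_pos x hx.1
      refine ⟨min (M.g x / 2) (M.g θ), lt_min (by positivity) hg, min_le_right _ _, fun hmem => ?_⟩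
      have h1 := hm hmem
      have h2 := min_le_left (M.g x / 2) (M.g θ)
      linarith
  · have hfin := hf _ (fun x hx => hx.1) (hM2.isCompact_level (M.g θ / 2) (by positivity))
    obtain ⟨c, hc, hcn⟩ := ((Ioo_infinite (half_lt_self hg)).sdiff hfin).nonempty
    refine ⟨c, by linarith [hc.1], hc.2.le, ?_⟩
    rintro ⟨x, hx, rfl⟩
    exact hcn ⟨x, ⟨hx, hx.1, hc.1.le⟩, rfl⟩

end CondM2

end ExpModel

/-! ### Tempered densities and the tempered E-step -/

/-- Weighted AM–GM between the exponents `1` and `1 ± ε`; summing both endpoints covers either sign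
of `s`. -/
theorem Real.rpow_one_add_mul_le {x ε s : ℝ} (hx : 0 < x) (hs : |s| ≤ 1) :
    x ^ (1 + s * ε) ≤ x + |s| * (x ^ (1 + ε) + x ^ (1 - ε)) := by
  have key : ∀ δ t : ℝ, 0 ≤ t → t ≤ 1 → x ^ (1 + t * δ) ≤ x + t * x ^ (1 + δ) := by
    intro δ t h0 h1
    have h2 := Real.geom_mean_le_arith_mean2_weighted (sub_nonneg.2 h1) h0 hx.le
      (Real.rpow_nonneg hx.le (1 + δ)) (by ring)
    rw [← Real.rpow_mul hx.le, ← Real.rpow_add hx] at h2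
    have h3 : 1 - t + (1 + δ) * t = 1 + t * δ := by ring
    rw [h3] at h2
    have := mul_nonneg h0 hx.le
    linarith
  have h1 := Real.rpow_nonneg hx.le (1 + ε)
  have h2 := Real.rpow_nonneg hx.le (1 - ε)
  rcases le_total 0 s with h | h
  · rw [abs_of_nonneg h] at hs ⊢
    have := key ε s h hs
    have := mul_nonneg h h2
    linarith
  · rw [abs_of_nonpos h] at hs ⊢
    have h3 := key (-ε) (-s) (by linarith) hs
    have h4 := mul_nonneg (neg_nonneg.2 h) h1
    rw [neg_mul_neg, ← sub_eq_add_neg] at h3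
    linarith

/-- AM–GM; it turns an upper bound for `∫ p^(2-α)` into a lower bound for `∫ p^α`. -/
theorem Real.two_mul_le_rpow_add_rpow {x : ℝ} (hx : 0 < x) (t : ℝ) :
    2 * x ≤ x ^ (1 + t) + x ^ (1 - t) := by
  have h1 : x ^ ((1 + t) / 2) * x ^ ((1 - t) / 2) = x := by
    rw [← Real.rpow_add hx]; ring_nf; exact Real.rpow_one x
  have h2 : (x ^ ((1 + t) / 2)) ^ 2 = x ^ (1 + t) := by
    rw [← Real.rpow_natCast, ← Real.rpow_mul hx.le]; norm_num
  have h3 : (x ^ ((1 - t) / 2)) ^ 2 = x ^ (1 - t) := by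
    rw [← Real.rpow_natCast, ← Real.rpow_mul hx.le]; norm_num
  have := sq_nonneg (x ^ ((1 + t) / 2) - x ^ ((1 - t) / 2))
  nlinarith

namespace ExpModel

variable {l q : ℕ} {X : Type*} [MeasurableSpace X] {M : ExpModel l q X}
  {θhat : EuclideanSpace ℝ (Fin q) → EuclideanSpace ℝ (Fin l)}
  {θ : EuclideanSpace ℝ (Fin l)} {C : Set (EuclideanSpace ℝ (Fin l))}

theorem integrable_rpow_of_lintegral_lt_top (hM1 : M.CondM1) (hM2 : M.CondM2 θhat)
    (hθ : θ ∈ M.Θ) {α : ℝ} (hα : ∫⁻ z, ENNReal.ofReal (M.dens θ z ^ α) ∂M.μ < ∞) :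
    Integrable (fun z => M.dens θ z ^ α) M.μ := by
  refine ⟨((hM1.measurable_dens θ).pow_const α).aestronglyMeasurable, ?_⟩
  rwa [hasFiniteIntegral_iff_ofReal
    (Eventually.of_forall fun z => Real.rpow_nonneg (hM2.dens_pos hθ z).le α)]

/-- The integral of `p_θ^α` tends to `1` as `α → 1`, at a linear rate that is uniform on compact
sets. -/
theorem exists_integral_rpow_le (hM1 : M.CondM1) (hM2 : M.CondM2 θhat) (hα : M.TemperingCond)
    (hCΘ : C ⊆ M.Θ) (hC : IsCompact C) : ∃ ε c : ℝ, 0 < ε ∧ ∀ θ ∈ C, ∀ α, |α - 1| ≤ ε →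
      Integrable (fun z => M.dens θ z ^ α) M.μ ∧
      |∫ z, M.dens θ z ^ α ∂M.μ - 1| ≤ c * |α - 1| := by
  obtain ⟨ε, hε, hb⟩ := hα C hCΘ hC
  have hp := (hb (1 + ε) (by simp [abs_of_pos hε])).1
  have hm := (hb (1 - ε) (by simp [abs_of_pos hε])).1
  set bp := ⨆ θ ∈ C, ∫⁻ z, ENNReal.ofReal (M.dens θ z ^ (1 + ε)) ∂M.μ
  set bm := ⨆ θ ∈ C, ∫⁻ z, ENNReal.ofReal (M.dens θ z ^ (1 - ε)) ∂M.μ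
  refine ⟨ε, (bp.toReal + bm.toReal) / ε, hε, fun θ hθ => ?_⟩
  have hθΘ := hCΘ hθ
  have hint : ∀ α, |α - 1| ≤ ε → Integrable (fun z => M.dens θ z ^ α) M.μ := fun α h =>
    integrable_rpow_of_lintegral_lt_top hM1 hM2 hθΘ ((le_iSup₂ (f := fun θ (_ : θ ∈ C) =>
      ∫⁻ z, ENNReal.ofReal (M.dens θ z ^ α) ∂M.μ) θ hθ).trans_lt (hb α (by
        rwa [Metric.mem_closedBall, Real.dist_eq])).1)
  have hbd : ∀ α : ℝ, Integrable (fun z => M.dens θ z ^ α) M.μ → ∀ b : ℝ≥0∞, b < ∞ →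
      ∫⁻ z, ENNReal.ofReal (M.dens θ z ^ α) ∂M.μ ≤ b → ∫ z, M.dens θ z ^ α ∂M.μ ≤ b.toReal := by
    intro α hi b hb hle
    rw [integral_eq_lintegral_of_nonneg_ae
      (Eventually.of_forall fun z => Real.rpow_nonneg (hM2.dens_pos hθΘ z).le α)
      hi.aestronglyMeasurable]
    exact ENNReal.toReal_mono hb.ne hle
  have ip := hint (1 + ε) (by simp [abs_of_pos hε])
  have im := hint (1 - ε) (by simp [abs_of_pos hε])
  have cp := hbd _ ip bp hp (le_iSup₂ (f := fun θ (_ : θ ∈ C) =>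
      ∫⁻ z, ENNReal.ofReal (M.dens θ z ^ (1 + ε)) ∂M.μ) θ hθ)
  have cm := hbd _ im bm hm (le_iSup₂ (f := fun θ (_ : θ ∈ C) =>
      ∫⁻ z, ENNReal.ofReal (M.dens θ z ^ (1 - ε)) ∂M.μ) θ hθ)
  have i1 := hM2.integrable_dens hθΘ
  have upper : ∀ α, |α - 1| ≤ ε →
      ∫ z, M.dens θ z ^ α ∂M.μ ≤ 1 + (bp.toReal + bm.toReal) / ε * |α - 1| := by
    intro α h
    have hs : |(α - 1) / ε| ≤ 1 := by rwa [abs_div, abs_of_pos hε, div_le_one hε]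
    have h1 := integral_mono (hint α h)
      (i1.add ((ip.add im).const_mul |(α - 1) / ε|)) fun z => by
        have := Real.rpow_one_add_mul_le (ε := ε) (hM2.dens_pos hθΘ z) hs
        rw [div_mul_cancel₀ _ hε.ne', add_sub_cancel] at this
        exact this
    have e1 := integral_add i1 ((ip.add im).const_mul |(α - 1) / ε|)
    have e2 := integral_add ip im
    simp only [Pi.add_apply] at h1 e1 e2
    rw [e1, integral_const_mul, e2, hM2.integral_dens hθΘ, abs_div, abs_of_pos hε] at h1
    refine h1.trans (add_le_add_right ?_ 1)
    calc _ ≤ |α - 1| / ε * (bp.toReal + bm.toReal) :=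
          mul_le_mul_of_nonneg_left (add_le_add cp cm) (by positivity)
      _ = _ := by ring
  intro α h
  refine ⟨hint α h, abs_le.2 ⟨?_, by linarith [upper α h]⟩⟩
  have h' : |(2 - α) - 1| ≤ ε := by rw [abs_sub_comm] at h; convert h using 2; ring
  have h1 := integral_mono (i1.const_mul 2) ((hint α h).add (hint _ h')) fun z => by
    have := Real.two_mul_le_rpow_add_rpow (hM2.dens_pos hθΘ z) (α - 1)
    rw [add_sub_cancel, show 1 - (α - 1) = 2 - α by ring] at this
    exact this
  have e2 := integral_add (hint α h) (hint _ h')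
  simp only [Pi.add_apply] at h1 e2
  rw [e2, integral_const_mul, hM2.integral_dens hθΘ] at h1
  have h2 := upper _ h'
  rw [show |2 - α - 1| = |α - 1| by rw [abs_sub_comm]; ring_nf] at h2
  linarith

theorem lintegral_temperedDens_div_sub_one_sq (hM2 : M.CondM2 θhat) (hθ : θ ∈ M.Θ) {T : ℝ}
    (i1 : Integrable (fun z => M.dens θ z ^ (1 / T)) M.μ)
    (i2 : Integrable (fun z => M.dens θ z ^ (2 * (1 / T) - 1)) M.μ)
    (hZ : 0 < ∫ z, M.dens θ z ^ (1 / T) ∂M.μ) :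
    ∫⁻ z, ENNReal.ofReal ((M.temperedDens T θ z / M.dens θ z - 1) ^ 2 * M.dens θ z) ∂M.μ =
      ENNReal.ofReal ((∫ z, M.dens θ z ^ (2 * (1 / T) - 1) ∂M.μ) /
        (∫ z, M.dens θ z ^ (1 / T) ∂M.μ) ^ 2 - 1) := by
  set Z := ∫ z, M.dens θ z ^ (1 / T) ∂M.μ with hZdef
  have e : (fun z => (M.temperedDens T θ z / M.dens θ z - 1) ^ 2 * M.dens θ z) = fun z =>
      M.dens θ z ^ (2 * (1 / T) - 1) / Z ^ 2 - 2 / Z * M.dens θ z ^ (1 / T) + M.dens θ z := by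
    funext z
    have hp := hM2.dens_pos hθ z
    rw [temperedDens, ← hZdef, Real.rpow_sub hp, Real.rpow_one, two_mul, Real.rpow_add hp]
    field_simp
    ring
  have j1 := i2.div_const (Z ^ 2)
  have j2 := i1.const_mul (2 / Z)
  have j3 := hM2.integrable_dens hθ
  have hi : Integrable (fun z => (M.temperedDens T θ z / M.dens θ z - 1) ^ 2 * M.dens θ z) M.μ := by
    rw [e]; exact (j1.sub j2).add j3
  rw [← ofReal_integral_eq_lintegral_ofReal hi (Eventually.of_forall fun z =>
    mul_nonneg (sq_nonneg _) (hM2.dens_pos hθ z).le), e]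
  have e1 := integral_add (j1.sub j2) j3
  have e2 := integral_sub j1 j2
  simp only [Pi.sub_apply] at e1 e2
  rw [e1, e2, integral_div, integral_const_mul, ← hZdef, hM2.integral_dens hθ,
    div_mul_cancel₀ _ hZ.ne']
  congr 1
  ring

theorem tendsto_iSup_lintegral_temperedDens (hM1 : M.CondM1) (hM2 : M.CondM2 θhat)
    (hα : M.TemperingCond) {T : ℕ → ℝ} (hT : Tendsto T atTop (𝓝 1))
    (hCΘ : C ⊆ M.Θ) (hC : IsCompact C) :
    Tendsto (fun n => ⨆ θ ∈ C, ∫⁻ z, ENNReal.ofReal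
      ((M.temperedDens (T n) θ z / M.dens θ z - 1) ^ 2 * M.dens θ z) ∂M.μ) atTop (𝓝 0) := by
  obtain ⟨ε, c, hε, hb⟩ := exists_integral_rpow_le hM1 hM2 hα hCΘ hC
  have hβ : Tendsto (fun n => |1 / T n - 1|) atTop (𝓝 0) := by
    have := ((tendsto_const_nhds (x := (1 : ℝ))).div hT one_ne_zero).sub_const 1
    simpa using this.abs
  have ha : Tendsto (fun n => c * |1 / T n - 1|) atTop (𝓝 0) := by simpa using hβ.const_mul c
  have hlim : Tendsto (fun n => ENNReal.ofReal ((1 + 2 * (c * |1 / T n - 1|)) /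
      (1 - c * |1 / T n - 1|) ^ 2 - 1)) atTop (𝓝 0) := by
    have h1 : Tendsto (fun n => (1 + 2 * (c * |1 / T n - 1|)) /
        (1 - c * |1 / T n - 1|) ^ 2 - 1) atTop (𝓝 ((1 + 2 * 0) / (1 - 0) ^ 2 - 1)) :=
      (((ha.const_mul 2).const_add 1).div ((ha.const_sub 1).pow 2) (by norm_num)).sub_const 1
    simpa using ENNReal.tendsto_ofReal h1
  refine tendsto_of_tendsto_of_tendsto_of_le_of_le' tendsto_const_nhds hlim
    (Eventually.of_forall fun _ => zero_le) ?_
  -- The exponent `2α - 1` is twice as far from `1` as `α`, hence `ε / 2`; the second bound keeps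
  -- the normaliser away from `0`.
  filter_upwards [hβ.eventually_le_const (show 0 < ε / 2 by positivity),
    ha.eventually_lt_const one_pos] with n h1 h2
  refine iSup₂_le fun θ hθ => ?_
  obtain ⟨i1, b1⟩ := hb θ hθ (1 / T n) (by linarith)
  have h3 : |2 * (1 / T n) - 1 - 1| = 2 * |1 / T n - 1| := by
    rw [← abs_two, ← abs_mul, abs_two]; ring_nf
  obtain ⟨i2, b2⟩ := hb θ hθ (2 * (1 / T n) - 1) (by rw [h3]; linarith)
  rw [h3] at b2
  have l1 := (abs_le.1 b1).1
  have l2 := (abs_le.1 b2).2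
  rw [lintegral_temperedDens_div_sub_one_sq hM2 (hCΘ hθ) i1 i2 (by linarith)]
  refine ENNReal.ofReal_le_ofReal (sub_le_sub_right ?_ 1)
  have hpos : 0 < 1 - c * |1 / T n - 1| := by linarith
  have l3 : 0 ≤ c * |1 / T n - 1| := (abs_nonneg _).trans b1
  exact div_le_div₀ (by linarith) (by linarith) (by positivity)
    (pow_le_pow_left₀ hpos.le (by linarith) 2)

theorem exists_lintegral_normSq_le (hM1 : M.CondM1) (hM2 : M.CondM2 θhat) (hα : M.TemperingCond)
    (hCΘ : C ⊆ M.Θ) (hC : IsCompact C) : ∃ B : ℝ≥0∞, B ≠ ∞ ∧ ∀ θ ∈ C,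
      ∫⁻ z, ENNReal.ofReal (‖M.S z‖ ^ 2 * M.dens θ z) ∂M.μ ≤ B := by
  obtain ⟨ε, hε, hb⟩ := hα C hCΘ hC
  have hb1 := (hb 1 (Metric.mem_closedBall_self hε.le)).2
  simp only [Real.rpow_one] at hb1
  refine ⟨_, (ENNReal.sum_lt_top.2 fun u (_ : u ∈ Finset.univ) => hb1 u).ne, fun θ hθ => ?_⟩
  have hmS := hM1.measurable_S
  have hmd := hM1.measurable_dens θ
  have e : ∀ z, ENNReal.ofReal (‖M.S z‖ ^ 2 * M.dens θ z) =
      ∑ u, ENNReal.ofReal ((M.S z u) ^ 2 * M.dens θ z) := fun z => by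
    rw [← ENNReal.ofReal_sum_of_nonneg fun u _ =>
      mul_nonneg (sq_nonneg _) (hM2.dens_pos (hCΘ hθ) z).le, ← Finset.sum_mul,
      EuclideanSpace.real_norm_sq_eq]
  simp_rw [e]
  rw [lintegral_finsetSum _ fun u _ => by fun_prop]
  exact Finset.sum_le_sum fun u _ => le_iSup₂ (f := fun θ (_ : θ ∈ C) =>
    ∫⁻ z, ENNReal.ofReal ((M.S z u) ^ 2 * M.dens θ z) ∂M.μ) θ hθ

/-- Cauchy–Schwarz for `S` and `p̃ / p - 1` in `L²(p_θ μ)`, with one factor `√p` given to each. -/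
theorem enorm_temperedS_sub_Sbar_le (hM1 : M.CondM1) (hM2 : M.CondM2 θhat) (hθ : θ ∈ M.Θ) {T : ℝ}
    (hT : M.TemperedStepDefined T θ) : ‖M.temperedS T θ - M.Sbar θ‖ₑ ≤
      (∫⁻ z, ENNReal.ofReal (‖M.S z‖ ^ 2 * M.dens θ z) ∂M.μ) ^ (1 / 2 : ℝ) *
      (∫⁻ z, ENNReal.ofReal ((M.temperedDens T θ z / M.dens θ z - 1) ^ 2 * M.dens θ z) ∂M.μ) ^
        (1 / 2 : ℝ) := by
  have hmS := hM1.measurable_S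
  have hmd := hM1.measurable_dens θ
  have hmt : Measurable (M.temperedDens T θ) := (hmd.pow_const _).div_const _
  rw [temperedS, Sbar, ← integral_sub hT.integrable_stat (hM2.integrable_Sbar θ hθ)]
  refine (enorm_integral_le_lintegral_enorm _).trans ?_
  have hCS := ENNReal.lintegral_mul_le_Lp_mul_Lq M.μ Real.HolderConjugate.two_two
    (f := fun z => ENNReal.ofReal (‖M.S z‖ * √(M.dens θ z)))
    (g := fun z => ENNReal.ofReal (|M.temperedDens T θ z / M.dens θ z - 1| * √(M.dens θ z)))
    (by fun_prop) (by fun_prop)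
  have key : ∀ a d : ℝ, 0 ≤ a → 0 < d →
      ENNReal.ofReal (a * √d) ^ (2 : ℝ) = ENNReal.ofReal (a ^ 2 * d) := fun a d ha hd => by
    rw [ENNReal.ofReal_rpow_of_nonneg (by positivity) (by norm_num), Real.rpow_two, mul_pow,
      Real.sq_sqrt hd.le]
  have e1 : ∀ z, ENNReal.ofReal (‖M.S z‖ * √(M.dens θ z)) ^ (2 : ℝ) =
      ENNReal.ofReal (‖M.S z‖ ^ 2 * M.dens θ z) := fun z =>
    key _ _ (norm_nonneg _) (hM2.dens_pos hθ z)
  have e2 : ∀ z, ENNReal.ofReal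
      (|M.temperedDens T θ z / M.dens θ z - 1| * √(M.dens θ z)) ^ (2 : ℝ) =
      ENNReal.ofReal ((M.temperedDens T θ z / M.dens θ z - 1) ^ 2 * M.dens θ z) := fun z => by
    rw [key _ _ (abs_nonneg _) (hM2.dens_pos hθ z), sq_abs]
  simp only [e1, e2] at hCS
  refine le_trans (le_of_eq (lintegral_congr fun z => ?_)) hCS
  have hp := hM2.dens_pos hθ z
  rw [Pi.mul_apply, ← ENNReal.ofReal_mul (by positivity), ← ofReal_norm, ← sub_smul, norm_smul,
    Real.norm_eq_abs]
  congr 1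
  have : M.temperedDens T θ z - M.dens θ z =
      (M.temperedDens T θ z / M.dens θ z - 1) * M.dens θ z := by field_simp
  rw [this, abs_mul, abs_of_pos hp]
  nth_rewrite 2 [← Real.mul_self_sqrt hp.le]
  ring

/-- Along a sequence at which the tempered E-steps are defined, the tempered EM map converges
continuously to the exact EM map. -/
theorem tendsto_temperedMap (hM1 : M.CondM1) (hM2 : M.CondM2 θhat) (hα : M.TemperingCond)
    {T : ℕ → ℝ} (hT : Tendsto T atTop (𝓝 1)) {t : ℕ → EuclideanSpace ℝ (Fin l)}
    (ht : ∀ n, t n ∈ M.Θ) (hdef : ∀ n, M.TemperedStepDefined (T n) (t n)) {U : Filter ℕ}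
    (hU : U ≤ atTop) (hθ : θ ∈ M.Θ) (htθ : Tendsto t U (𝓝 θ)) :
    Tendsto (fun n => θhat (M.temperedS (T n) (t n))) U (𝓝 (θhat (M.Sbar θ))) := by
  have htθ' : Tendsto t U (𝓝[M.Θ] θ) := tendsto_nhdsWithin_iff.2 ⟨htθ, Eventually.of_forall ht⟩
  have hg := hM2.g_pos θ hθ
  -- By continuity of `g`, this compact set eventually contains `t n`, so the uniform bounds apply.
  have hC := hM2.isCompact_level (M.g θ / 2) (by positivity)
  have hCΘ : {x ∈ M.Θ | M.g θ / 2 ≤ M.g x} ⊆ M.Θ := fun x hx => hx.1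
  have htC : ∀ᶠ n in U, t n ∈ {x ∈ M.Θ | M.g θ / 2 ≤ M.g x} :=
    (((hM2.continuousOn_g θ hθ).tendsto.comp htθ').eventually_const_le (half_lt_self hg)).mono
      fun n hn => ⟨ht n, hn⟩
  obtain ⟨B, hB, hBC⟩ := exists_lintegral_normSq_le hM1 hM2 hα hCΘ hC
  have hχ := (tendsto_iSup_lintegral_temperedDens hM1 hM2 hα hT hCΘ hC).mono_left hU
  have hlim := ENNReal.Tendsto.const_mul (a := B ^ (1 / 2 : ℝ)) (hχ.ennrpow_const (1 / 2 : ℝ))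
    (Or.inr (ENNReal.rpow_ne_top_of_nonneg (by norm_num) hB))
  rw [ENNReal.zero_rpow_of_pos (by norm_num), mul_zero] at hlim
  have hsub : Tendsto (fun n => M.temperedS (T n) (t n) - M.Sbar (t n)) U (𝓝 0) := by
    refine tendsto_zero_iff_enorm_tendsto_zero.2 ?_
    refine tendsto_of_tendsto_of_tendsto_of_le_of_le' tendsto_const_nhds hlim
      (Eventually.of_forall fun _ => zero_le) (htC.mono fun n hn => ?_)
    refine (enorm_temperedS_sub_Sbar_le hM1 hM2 (ht n) (hdef n)).trans ?_
    refine mul_le_mul' (ENNReal.rpow_le_rpow (hBC _ hn) (by norm_num))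
      (ENNReal.rpow_le_rpow ?_ (by norm_num))
    exact le_iSup₂ (f := fun θ' (_ : θ' ∈ {x ∈ M.Θ | M.g θ / 2 ≤ M.g x}) =>
      ∫⁻ z, ENNReal.ofReal ((M.temperedDens (T n) θ' z / M.dens θ' z - 1) ^ 2 * M.dens θ' z) ∂M.μ)
      _ hn
  have hS : Tendsto (fun n => M.temperedS (T n) (t n)) U (𝓝 (M.Sbar θ)) := by
    simpa using hsub.add ((hM2.continuousOn_Sbar θ hθ).tendsto.comp htθ')
  exact (hM2.continuousOn_θhat _ (hM2.Sbar_mem θ hθ)).tendsto.comp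
    (tendsto_nhdsWithin_iff.2 ⟨hS, Eventually.of_forall fun n => (hdef n).mem_Sdom⟩)

end ExpModel

/-! ### Convergence of stable tempered EM -/

theorem mainTheorem2 {l q : ℕ} {X : Type*} [MeasurableSpace X] (M : ExpModel l q X)
    (θhat : EuclideanSpace ℝ (Fin q) → EuclideanSpace ℝ (Fin l))
    (hM1 : M.CondM1) (hM2 : M.CondM2 θhat) (hM3 : M.CondM3 θhat)
    (hα : M.TemperingCond)
    (T : ℕ → ℝ) (hTpos : ∀ n, 0 < T n) (hT : Tendsto T atTop (𝓝 1)) :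
    -- the tempered density is close to the exact one, uniformly on compact sets
    (∀ C ⊆ M.Θ, IsCompact C →
      Tendsto (fun n => ⨆ θ ∈ C, ∫⁻ z, ENNReal.ofReal
        ((M.temperedDens (T n) θ z / M.dens θ z - 1) ^ 2 * M.dens θ z) ∂M.μ) atTop (𝓝 0)) ∧
    -- every run of the stabilised tempered EM converges
    ∀ (K : ℕ → Set (EuclideanSpace ℝ (Fin l))) (θ : ℕ → EuclideanSpace ℝ (Fin l)) (p : ℕ → ℕ),
      IsCompactExhaustion M.Θ K →
      (∀ n, M.TemperedStepDefined (T n) (θ n)) →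
      IsStableIteration K (fun n t => θhat (M.temperedS (T n) t)) θ p →
      -- (i)(a)
      (limsup (fun n => (p n : ℕ∞)) atTop < ⊤ ∧
        IsCompact (closure (range θ)) ∧ closure (range θ) ⊆ M.Θ) ∧
      -- (i)(b)
      (∃ w ∈ M.g '' (M.statPoints θhat ∩ closure (range θ)),
        ConvergesToSet (fun n => M.g (θ n))
          (connectedComponentIn (M.g '' (M.statPoints θhat ∩ closure (range θ))) w)) ∧
      -- (ii)
      (interior (M.g '' (M.statPoints θhat ∩ closure (range θ))) = ∅ →
        ∃ w : ℝ, Tendsto (fun n => M.g (θ n)) atTop (𝓝 w) ∧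
          ConvergesToSet θ ({t ∈ M.statPoints θhat | M.g t = w} ∩ closure (range θ))) := by
  refine ⟨fun C hCΘ hC => M.tendsto_iSup_lintegral_temperedDens hM1 hM2 hα hT hCΘ hC,
    fun K θ p hK hdef hs => ?_⟩
  have hKΘ : ∀ n, K n ⊆ M.Θ := fun n => hK.iUnion_eq ▸ subset_iUnion K n
  have hθ : ∀ n, θ n ∈ M.Θ := fun n => hKΘ _ (hs.mem hK.monotone n)
  have h : IsAscentLimit M.Θ (fun n t => θhat (M.temperedS (T n) t)) (fun t => θhat (M.Sbar t))
      M.g θ :=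
    { mapsTo := hM2.mapsTo_map
      continuousOn_map := hM2.continuousOn_θhat.comp hM2.continuousOn_Sbar hM2.Sbar_mem
      continuousOn := hM2.continuousOn_g
      le_map := fun x hx => hM2.g_le_map hx
      fixed_of_eq := fun x hx => hM2.map_map_eq hx
      step_mem := fun n => hM2.mapsTo_θhat (hdef n).mem_Sdom
      tendsto_step := fun U hU x hx hUx =>
        M.tendsto_temperedMap hM1 hM2 hα hT hθ hdef hU hx hUx }
  obtain ⟨c, hc, hcθ, hcn⟩ := ExpModel.CondM2.exists_level_notMem hM2 hM3 (hθ 0)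
  have hlev := hM2.isCompact_level c hc
  obtain ⟨N, hN⟩ := hK.exists_subset _ (fun x hx => hx.1) hlev
  obtain ⟨P, hP⟩ := hs.bddAbove_count hK.monotone (W := {x ∈ M.Θ | c ≤ M.g x}) ⟨hθ 0, hcθ⟩ hN
    (h.eventually_step_mem_level hlev hcn)
  have hcl : closure (range θ) ⊆ K P := closure_minimal
    (range_subset_iff.2 fun n => hK.monotone (hP n) (hs.mem hK.monotone n)) (hK.isCompact P).isClosed
  have hC := (hK.isCompact P).of_isClosed_subset isClosed_closure hcl
  have hCΘ := hcl.trans (hKΘ P)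
  have hstep := hs.eventually_accept hP
  refine ⟨⟨?_, hC, hCΘ⟩, h.exists_convergesToSet_component hC hCΘ hstep, fun hint => ?_⟩
  · exact (limsup_le_of_le (a := (P : ℕ∞)) (by isBoundedDefault)
      (Eventually.of_forall fun n => Nat.cast_le.2 (hP n))).trans_lt (ENat.natCast_lt_top P)
  · obtain ⟨w, hw⟩ := h.exists_tendsto_of_interior_eq_empty hC hCΘ hstep hint
    exact ⟨w, hw, h.convergesToSet_of_tendsto hC hCΘ hstep hw⟩
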